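/- Theorem 8. Consider a stochastic bandit with arms $[k]=\{1,\dots,k\}$, $k\ge 1$, whose successive pulls of arm $i$ yield Bernoulli rewards of mean $\mu_i\in[0,1]$, all rewards being independent, where $\mu_1>\mu_2>\dots>\mu_k$, and put $\Delta_i=\mu_1-\mu_i$. Let $r=(r_1,\dots,r_k)$ with $r_i\in[0,1/k)$. For a horizon $T\ge 1$ the algorithm T-fair-ucb runs for $T$ rounds as follows. Let $n_i=\max(1,r_iT)$, rounded down or up to an integer (for each arm in either way), and $T'=\sum_i n_i$. In the first $T'$ rounds each arm $i$ is pulled exactly $n_i$ times, in any order (if $T'>T$, the run is cut off after round $T$). In every round $t=T'+1,\dots,T$ it pulls an arm $i$ that maximizes the UCB1 estimate $\hat\mu_i+\sqrt{2\ln t/N_{i,t-1}}$, ties being broken arbitrarily, where $N_{i,t}$ is the number of pulls of arm $i$ in the first $t$ rounds and $\hat\mu_i$ is the mean of all rewards of arm $i$ observed in the first $t-1$ rounds. Let $$\mathcal R^r(T)=\sum_{i\in[k]}\Delta_i\bigl(\mathbb E[N_{i,T}]-\lfloor r_iT\rfloor\bigr)$$ be its $r$-Regret (with unfairness tolerance $0$).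 Then $\mathcal R^r(T)=O(\ln T)$, that is, there is a constant $C$ depending only on $k$, $\mu$ and $r$ such that $|\mathcal R^r(T)|\le C\ln T$ for all $T\ge 2$; and for all $T\ge 1$ $$\mathcal R^r(T)\le\Bigl(1+\frac{\pi^2}{3}\Bigr)\sum_{i\in[k]}\Delta_i+\sum_{i\in S(T),\,i\ne 1}\Delta_i\Bigl(\frac{8\ln T}{\Delta_i^2}-r_iT\Bigr),\qquad S(T)=\Bigl\{i\in[k],\ i\neq 1:\ r_iT<\frac{8\ln T}{\Delta_i^2}\Bigr\}\ .$$ -/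

import Mathlib

open MeasureTheory ProbabilityTheory
open scoped unitInterval

namespace FairMAB

noncomputable section

variable {k : ℕ}

/-- Bernoulli rewards: `X i s` is the reward collected at the `(s+1)`-th pull of arm `i`. All these
rewards are independent, and those of arm `i` are Bernoulli with mean `μ i`. -/
structure IsBernoulliRewards {Ω : Type*} [MeasurableSpace Ω] (P : Measure Ω) (μ : Fin k → I)
    (X : Fin k → ℕ → Ω → ℝ) : Prop where
  law : ∀ i s, HasLaw (X i s) (bernoulliMeasure (1 : ℝ) 0 (μ i)) P
  indep : iIndepFun (fun p : Fin k × ℕ => X p.1 p.2) P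

/-- `pulls a i t` is the number of pulls of arm `i` in the first `t` rounds,
where `a s` is the arm pulled in round `s + 1`. -/
def pulls (a : ℕ → Fin k) (i : Fin k) (t : ℕ) : ℕ :=
  ((Finset.range t).filter fun s => a s = i).card

/-- The empirical mean of the first `n` rewards `x 0, …, x (n - 1)` of an arm. -/
def empMean (x : ℕ → ℝ) (n : ℕ) : ℝ :=
  (∑ s ∈ Finset.range n, x s) / n

/-- The UCB1 estimate of arm `i` used in round `t + 1`, that is after `t` rounds: the empirical mean
of the rewards of the arm so far plus the confidence width `√(2 ln (t + 1) / N)`, where `N` is the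
number of pulls so far, and `0` if the arm has not been pulled. -/
def ucbEstimate (x : Fin k → ℕ → ℝ) (a : ℕ → Fin k) (i : Fin k) (t : ℕ) : ℝ :=
  if pulls a i t = 0 then 0
  else empMean (x i) (pulls a i t) + √(2 * Real.log ((t : ℝ) + 1) / (pulls a i t : ℝ))

/-- `n` gives the lengths of the initial pulls: `n i` is `max (1, r i * T)`, rounded down or up
when this is not an integer (each arm may be rounded either way). -/
def IsInitialPulls (r : Fin k → ℝ) (T : ℕ) (n : Fin k → ℕ) : Prop :=
  ∀ i, n i = ⌊max 1 (r i * T)⌋₊ ∨ n i = ⌈max 1 (r i * T)⌉₊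

/-- The sequence of arms `a` is a run, over the horizon of `T` rounds, of the T-fair-ucb algorithm
with initial pulls `n`, when the rewards of the arms are `x`. In the first `T' = ∑ i, n i` rounds
each arm `i` is pulled exactly `n i` times, in any order (if `T < T'` the run is cut off after round
`T`); every later round pulls an arm with the highest UCB1 estimate, ties being broken in any way. -/
structure IsTFairUCBRun (T : ℕ) (n : Fin k → ℕ) (x : Fin k → ℕ → ℝ) (a : ℕ → Fin k) : Prop where
  initial : ∑ i, n i ≤ T → ∀ i, pulls a i (∑ j, n j) = n i
  initial_cut : T < ∑ i, n i → ∀ i, pulls a i T ≤ n i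
  ucb : ∀ t, ∑ i, n i ≤ t → t < T → ∀ j, ucbEstimate x a j t ≤ ucbEstimate x a (a t) t

/-- The gap `Δ i = μ 1 - μ i`, where the first arm is indexed by `0`. -/
def gap [NeZero k] (μ : Fin k → I) (i : Fin k) : ℝ := (μ 0 : ℝ) - μ i

/-- The `r`-Regret after `T` rounds, for the unfairness tolerance `α`, of an algorithm that pulls the
random arm `a t` in round `t + 1`. -/
def rRegret [NeZero k] {Ω : Type*} [MeasurableSpace Ω] (P : Measure Ω) (μ : Fin k → I)
    (r : Fin k → ℝ) (α : ℝ) (T : ℕ) (a : ℕ → Ω → Fin k) : ℝ :=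
  ∑ i, gap μ i *
    ((∫ ω, (pulls (fun t => a t ω) i T : ℝ) ∂P) - max 0 ((⌊r i * T⌋ : ℝ) - α))

/-- The set `S(T)` of the arms whose quota `r i * T` is below `8 ln T / Δ i ^ 2`. -/
def underSampled [NeZero k] (μ : Fin k → I) (r : Fin k → ℝ) (T : ℕ) : Set (Fin k) :=
  {i | r i * T < 8 * Real.log T / gap μ i ^ 2}

end

end FairMAB

/-! Each suboptimal arm `i` is bounded separately. Let `M` be an integer with `n i ≤ M` and `8 ln T
/ Δ i ^ 2 ≤ M`. Pulls beyond the `M`-th fall in UCB rounds where arm `i` has a confidence width of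
at most `Δ i / 2`. Preferring it to the best arm then forces one of the two empirical means to miss
its true mean by a full width (`deviation_of_ucbEstimate_le`). Rewards are indexed by pull number,
so for fixed counts Hoeffding applies whatever the algorithm does. A union bound over the possible
counts gives probability at most `2t/(t+1)^4` (`measureReal_latePull_le`), which sums to at most 2,
so the expected number of pulls is at most `M + 2`.

For the lower bound, `∑ r i < 1` means that a quota can be missed only for bounded `T`, so the
deficit is bounded too (`neg_le_integral_pulls_sub_floor`). -/

namespace FairMAB

/-! ### Pull counts and rounded quotas -/

section Deterministic

variable {k : ℕ}

lemma pulls_succ (a : ℕ → Fin k) (i : Fin k) (t : ℕ) :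
    pulls a i (t + 1) = pulls a i t + if a t = i then 1 else 0 := by
  unfold pulls
  rw [Finset.range_add_one, Finset.filter_insert]
  split_ifs with h <;> simp

lemma pulls_mono (a : ℕ → Fin k) (i : Fin k) : Monotone (pulls a i) :=
  monotone_nat_of_le_succ fun t => by rw [pulls_succ]; omega

lemma pulls_le (a : ℕ → Fin k) (i : Fin k) (t : ℕ) : pulls a i t ≤ t := by
  simpa [pulls] using Finset.card_filter_le (Finset.range t) fun s => a s = i

/-- Once an arm has been pulled at most `M` times, its later pulls beyond the `M`-th are those of
the rounds where it is pulled after at least `M` earlier pulls. -/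
lemma pulls_le_add_card (a : ℕ → Fin k) (i : Fin k) {m T M : ℕ} (hm : pulls a i m ≤ M)
    (hT : m ≤ T) :
    pulls a i T ≤ M + ∑ t ∈ Finset.Ico m T, if a t = i ∧ M ≤ pulls a i t then 1 else 0 := by
  induction T, hT using Nat.le_induction with
  | base => simpa using hm
  | succ T hT ih =>
    rw [pulls_succ, Finset.sum_Ico_succ_top hT]
    by_cases h : a T = i <;> by_cases h' : M ≤ pulls a i T <;>
      simp only [h, h', and_self, and_false, false_and, if_true, if_false] <;> omega

variable {r : Fin k → ℝ} {T : ℕ} {n : Fin k → ℕ}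

lemma IsInitialPulls.one_le (h : IsInitialPulls r T n) (i : Fin k) : 1 ≤ n i := by
  rcases h i with h | h <;> rw [h]
  · exact Nat.le_floor (by simp)
  · exact Nat.one_le_ceil_iff.2 (by simp)

lemma IsInitialPulls.floor_le (h : IsInitialPulls r T n) (i : Fin k) : ⌊r i * T⌋₊ ≤ n i := by
  have h₁ : ⌊r i * T⌋₊ ≤ ⌊max 1 (r i * T)⌋₊ := Nat.floor_le_floor (le_max_right _ _)
  rcases h i with h | h <;> rw [h]
  · exact h₁
  · exact h₁.trans (Nat.floor_le_ceil _)

lemma IsInitialPulls.le_floor_add_one (h : IsInitialPulls r T n) (i : Fin k) :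
    n i ≤ ⌊r i * T⌋₊ + 1 := by
  have h₁ : ⌈max 1 (r i * T)⌉₊ ≤ ⌊r i * T⌋₊ + 1 := by
    refine Nat.ceil_le.2 (max_le ?_ ?_)
    · push_cast
      linarith [Nat.cast_nonneg (α := ℝ) ⌊r i * T⌋₊]
    · push_cast
      exact (Nat.lt_floor_add_one _).le
  rcases h i with h | h <;> rw [h]
  · exact (Nat.floor_le_ceil _).trans h₁
  · exact h₁

end Deterministic

/-! ### Gaps and the comparison of UCB estimates -/

section Gap

variable {k : ℕ} [NeZero k] {μ : Fin k → I}

lemma gap_zero : gap μ 0 = 0 := by simp [gap]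

lemma gap_pos (hμ : StrictAnti μ) {i : Fin k} (hi : i ≠ 0) : 0 < gap μ i := by
  have : μ i < μ 0 := hμ (Fin.pos_iff_ne_zero.2 hi)
  exact sub_pos.2 (by exact_mod_cast this)

lemma gap_nonneg (hμ : StrictAnti μ) (i : Fin k) : 0 ≤ gap μ i := by
  by_cases hi : i = 0
  · rw [hi, gap_zero]
  · exact (gap_pos hμ hi).le

/-- If UCB1 prefers a suboptimal arm which has been pulled sufficiently often, then the empirical
mean of this arm is too large or that of the best arm is too small. -/
lemma deviation_of_ucbEstimate_le {x : Fin k → ℕ → ℝ} {a : ℕ → Fin k} {i : Fin k} {t T : ℕ}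
    (hΔ : 0 < gap μ i) (htT : t < T) (h0 : pulls a 0 t ≠ 0) (hi : pulls a i t ≠ 0)
    (hM : 8 * Real.log T / gap μ i ^ 2 ≤ pulls a i t)
    (hu : ucbEstimate x a 0 t ≤ ucbEstimate x a i t) :
    empMean (x 0) (pulls a 0 t) + √(2 * Real.log ((t : ℝ) + 1) / (pulls a 0 t : ℝ)) ≤ μ 0 ∨
      μ i + √(2 * Real.log ((t : ℝ) + 1) / (pulls a i t : ℝ)) ≤ empMean (x i) (pulls a i t) := by
  by_contra! hcon
  obtain ⟨h₁, h₂⟩ := hcon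
  simp only [ucbEstimate, h0, hi, if_false] at hu
  have hlog : Real.log ((t : ℝ) + 1) ≤ Real.log T :=
    Real.log_le_log (by positivity) (by exact_mod_cast htT)
  have hp : (0 : ℝ) < pulls a i t := by positivity
  -- The constant 8 enters here: `2 ln(t+1) / N ≤ Δ ^ 2 / 4` as soon as `N ≥ 8 ln T / Δ ^ 2`.
  have hw : √(2 * Real.log ((t : ℝ) + 1) / (pulls a i t : ℝ)) ≤ gap μ i / 2 := by
    refine Real.sqrt_le_iff.2 ⟨by positivity, ?_⟩
    rw [div_le_iff₀ hp]
    rw [div_le_iff₀ (by positivity)] at hM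
    nlinarith
  have : (μ 0 : ℝ) - μ i = gap μ i := rfl
  linarith

end Gap

/-! ### Concentration of the empirical means -/

section Hoeffding

variable {Ω : Type*} [MeasurableSpace Ω] {P : Measure Ω}

/-- Hoeffding's inequality for sums of random variables with values in the unit interval. -/
lemma measureReal_sum_sub_ge_le [IsProbabilityMeasure P] {Y : ℕ → Ω → ℝ} {m a b : ℝ}
    (hab : b - a = 1)
    (hY : ∀ s, AEMeasurable (Y s) P) (hI : ∀ s, ∀ᵐ ω ∂P, Y s ω ∈ Set.Icc a b)
    (hm : ∀ s, ∫ ω, Y s ω ∂P = m) (hind : iIndepFun Y P) (s : ℕ) {ε : ℝ} (hε : 0 ≤ ε) :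
    P.real {ω | ε ≤ ∑ j ∈ Finset.range s, (Y j ω - m)} ≤ Real.exp (-2 * ε ^ 2 / s) := by
  have hsub : ∀ j < s, HasSubgaussianMGF (fun ω => Y j ω - m) ((‖b - a‖₊ / 2) ^ 2) P := by
    intro j _
    have := hasSubgaussianMGF_of_mem_Icc (hY j) (hI j)
    rwa [hm j] at this
  have hind' : iIndepFun (fun j ω => Y j ω - m) P :=
    hind.comp (fun _ y => y - m) fun _ => by fun_prop
  refine (HasSubgaussianMGF.measure_sum_range_ge_le_of_iIndepFun hind' hsub hε).trans_eq ?_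
  rw [hab]
  congr 1
  push_cast
  -- For `s = 0` both exponents are divisions by zero, hence 0.
  rcases eq_or_ne (s : ℝ) 0 with hs | hs
  · simp [hs]
  · norm_num
    field_simp
    norm_num

variable {k : ℕ} {μ : Fin k → I} {X : Fin k → ℕ → Ω → ℝ}

lemma IsBernoulliRewards.integral_eq (hX : IsBernoulliRewards P μ X) (i : Fin k) (s : ℕ) :
    ∫ ω, X i s ω ∂P = μ i := by
  rw [(hX.law i s).integral_eq, integral_bernoulliMeasure]
  simp

lemma IsBernoulliRewards.ae_mem_Icc (hX : IsBernoulliRewards P μ X) (i : Fin k) (s : ℕ) :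
    ∀ᵐ ω ∂P, X i s ω ∈ Set.Icc (0 : ℝ) 1 := by
  have h : MeasurableSet {x : ℝ | ¬ x ∈ Set.Icc (0 : ℝ) 1} := measurableSet_Icc.compl
  rw [ae_iff, (hX.law i s).measure_eq h]
  exact bernoulliMeasure_apply_of_notMem_of_notMem _ h (by simp) (by simp)

lemma IsBernoulliRewards.iIndepFun_arm (hX : IsBernoulliRewards P μ X) (i : Fin k) :
    iIndepFun (X i) P :=
  hX.indep.precomp (g := fun s : ℕ => (i, s)) fun _ _ h => (Prod.mk.inj h).2

/-- The UCB1 width is chosen so that the Hoeffding bound does not depend on the sample size `s`. -/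
lemma exp_neg_mul_sq_width {s : ℕ} (hs : s ≠ 0) {τ : ℝ} (hτ : 1 ≤ τ) :
    Real.exp (-2 * (s * √(2 * Real.log τ / s)) ^ 2 / s) = 1 / τ ^ 4 := by
  have hs' : (0 : ℝ) < s := by positivity
  have hl := Real.log_nonneg hτ
  rw [mul_pow, Real.sq_sqrt (by positivity)]
  have : -2 * ((s : ℝ) ^ 2 * (2 * Real.log τ / s)) / s = -Real.log (τ ^ 4) := by
    rw [Real.log_pow]
    field_simp
    push_cast
    ring
  rw [this, Real.exp_neg, Real.exp_log (by positivity), one_div]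

lemma IsBernoulliRewards.measureReal_empMean_ge_le [IsProbabilityMeasure P]
    (hX : IsBernoulliRewards P μ X) (i : Fin k) {s : ℕ} (hs : s ≠ 0) {τ : ℝ} (hτ : 1 ≤ τ) :
    P.real {ω | μ i + √(2 * Real.log τ / s) ≤ empMean (fun j => X i j ω) s} ≤ 1 / τ ^ 4 := by
  have hs' : (0 : ℝ) < s := by positivity
  rw [← exp_neg_mul_sq_width hs hτ]
  refine le_trans (measureReal_mono fun ω hω => ?_)
    (measureReal_sum_sub_ge_le (a := 0) (b := 1) (by norm_num) (fun j => (hX.law i j).aemeasurable)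
      (hX.ae_mem_Icc i) (hX.integral_eq i) (hX.iIndepFun_arm i) s (by positivity))
  simp only [Set.mem_ofPred_eq, empMean, le_div_iff₀ hs'] at hω ⊢
  simp only [Finset.sum_sub_distrib, Finset.sum_const, Finset.card_range, nsmul_eq_mul]
  linarith

/-- The lower tail is the upper tail of the negated rewards, which lie in `[-1, 0]`. -/
lemma IsBernoulliRewards.measureReal_empMean_le_le [IsProbabilityMeasure P]
    (hX : IsBernoulliRewards P μ X) (i : Fin k) {s : ℕ} (hs : s ≠ 0) {τ : ℝ} (hτ : 1 ≤ τ) :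
    P.real {ω | empMean (fun j => X i j ω) s + √(2 * Real.log τ / s) ≤ μ i} ≤ 1 / τ ^ 4 := by
  have hs' : (0 : ℝ) < s := by positivity
  rw [← exp_neg_mul_sq_width hs hτ]
  refine le_trans (measureReal_mono fun ω hω => ?_)
    (measureReal_sum_sub_ge_le (Y := fun j ω => -X i j ω) (m := -μ i) (a := -1) (b := 0)
      (by norm_num) (fun j => (hX.law i j).aemeasurable.neg)
      (fun j => ?_) (fun j => ?_) ?_ s (by positivity))
  · simp only [Set.mem_ofPred_eq, empMean] at hω ⊢
    rw [← le_sub_iff_add_le, div_le_iff₀ hs'] at hω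
    simp only [Finset.sum_sub_distrib, Finset.sum_const, Finset.card_range, nsmul_eq_mul,
      Finset.sum_neg_distrib]
    linarith
  · filter_upwards [hX.ae_mem_Icc i j] with ω hω
    exact ⟨by linarith [hω.2], by linarith [hω.1]⟩
  · rw [integral_neg, hX.integral_eq]
  · exact (hX.iIndepFun_arm i).comp (fun _ y => -y) fun _ => by fun_prop

end Hoeffding

/-- Each term is at most `2/t - 2/(t+1)`, and these differences telescope. -/
lemma sum_Ico_two_mul_div_le {m T : ℕ} (hm : 1 ≤ m) (hT : m ≤ T) :
    ∑ t ∈ Finset.Ico m T, 2 * (t : ℝ) / ((t : ℝ) + 1) ^ 4 ≤ (2 : ℝ) / m - 2 / T := by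
  induction T, hT using Nat.le_induction with
  | base => simp
  | succ T hT ih =>
    rw [Finset.sum_Ico_succ_top hT]
    have hT' : (0 : ℝ) < T := by exact_mod_cast hm.trans hT
    have : 2 * (T : ℝ) / ((T : ℝ) + 1) ^ 4 ≤ 2 / T - 2 / ((T : ℝ) + 1) := by
      rw [div_sub_div _ _ hT'.ne' (by positivity), div_le_div_iff₀ (by positivity) (by positivity)]
      have e : (2 * ((T : ℝ) + 1) - T * 2) * (T + 1) ^ 4 - 2 * T * (T * (T + 1))
          = 2 * (T + 1) * ((T + 1) ^ 3 - T ^ 2) := by ring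
      have : 0 ≤ 2 * ((T : ℝ) + 1) * ((T + 1) ^ 3 - T ^ 2) := by
        have : ((T : ℝ) + 1) ^ 3 - T ^ 2 = T ^ 3 + 2 * T ^ 2 + 3 * T + 1 := by ring
        rw [this]
        positivity
      linarith
    push_cast
    linarith

/-! ### Expected pulls and regret of a run -/

section Run

variable {k : ℕ} {μ : Fin k → I} {r : Fin k → ℝ} {T : ℕ} {n : Fin k → ℕ}
  {Ω : Type*} [MeasurableSpace Ω] {P : Measure Ω} {X : Fin k → ℕ → Ω → ℝ} {a : ℕ → Ω → Fin k}

lemma measurable_pulls (ha : ∀ t, Measurable (a t)) (i : Fin k) (t : ℕ) :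
    Measurable fun ω => pulls (fun s => a s ω) i t := by
  induction t with
  | zero => simp [pulls]
  | succ t ih =>
    simp only [pulls_succ]
    exact ih.add (Measurable.ite (ha t (measurableSet_singleton i)) measurable_const
      measurable_const)

lemma integrable_pulls [IsProbabilityMeasure P] (ha : ∀ t, Measurable (a t)) (i : Fin k) (t : ℕ) :
    Integrable (fun ω => (pulls (fun s => a s ω) i t : ℝ)) P := by
  refine Integrable.of_bound (C := t)
    (measurable_from_nat.comp (measurable_pulls ha i t)).aestronglyMeasurable
    (ae_of_all _ fun ω => ?_)
  simpa using pulls_le (fun s => a s ω) i t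

/-- The event that arm `i` is pulled in round `t + 1` after at least `M` earlier pulls. -/
def latePull (a : ℕ → Ω → Fin k) (i : Fin k) (M t : ℕ) : Set Ω :=
  {ω | a t ω = i ∧ M ≤ pulls (fun s => a s ω) i t}

lemma measurableSet_latePull (ha : ∀ t, Measurable (a t)) (i : Fin k) (M t : ℕ) :
    MeasurableSet (latePull a i M t) :=
  (ha t (measurableSet_singleton i)).inter (measurable_pulls ha i t measurableSet_Ici)

lemma integral_pulls_le_add_sum [IsProbabilityMeasure P] (ha : ∀ t, Measurable (a t)) (i : Fin k)
    {m M : ℕ} (hm : ∀ᵐ ω ∂P, pulls (fun s => a s ω) i m ≤ M) (hT : m ≤ T) :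
    ∫ ω, (pulls (fun s => a s ω) i T : ℝ) ∂P ≤
      M + ∑ t ∈ Finset.Ico m T, P.real (latePull a i M t) := by
  have hint : ∀ t ∈ Finset.Ico m T,
      Integrable ((latePull a i M t).indicator fun _ => (1 : ℝ)) P := fun t _ =>
    (integrable_const _).indicator (measurableSet_latePull ha i M t)
  have hsum : ∫ ω, ((M : ℝ) + ∑ t ∈ Finset.Ico m T,
      (latePull a i M t).indicator (fun _ => (1 : ℝ)) ω) ∂P =
      M + ∑ t ∈ Finset.Ico m T, P.real (latePull a i M t) := by
    rw [integral_add (integrable_const _) (integrable_finsetSum _ hint), integral_finsetSum _ hint]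
    simp [integral_indicator_const _ (measurableSet_latePull ha i M _)]
  rw [← hsum]
  refine integral_mono_ae (integrable_pulls ha i T)
    ((integrable_const _).add (integrable_finsetSum _ hint)) ?_
  filter_upwards [hm] with ω hω
  have h := pulls_le_add_card (fun s => a s ω) i hω hT
  refine (Nat.cast_le.2 h).trans_eq ?_
  push_cast
  simp [latePull, Set.indicator_apply]

/-- An arm misses its quota only if the run is cut off, which bounds the horizon. -/
lemma neg_le_integral_pulls_sub_floor [IsProbabilityMeasure P] (hr : ∀ i, 0 ≤ r i)
    (hr1 : ∑ i, r i < 1) (hr1' : ∀ i, r i ≤ 1) (hn : IsInitialPulls r T n)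
    (ha : ∀ t, Measurable (a t))
    (hrun : ∀ᵐ ω ∂P, IsTFairUCBRun T n (fun i s => X i s ω) (fun t => a t ω)) (i : Fin k) :
    -(k / (1 - ∑ i, r i)) ≤ ∫ ω, (pulls (fun s => a s ω) i T : ℝ) ∂P - ⌊r i * T⌋₊ := by
  have hρ : 0 < 1 - ∑ i, r i := by linarith
  rcases le_or_gt (∑ j, n j) T with hT | hT
  · have hle : ∫ _, (⌊r i * T⌋₊ : ℝ) ∂P ≤ ∫ ω, (pulls (fun s => a s ω) i T : ℝ) ∂P := by
      refine integral_mono_ae (integrable_const _) (integrable_pulls ha i T) ?_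
      filter_upwards [hrun] with ω hω
      refine Nat.cast_le.2 ((hn.floor_le i).trans ?_)
      rw [← hω.initial hT i]
      exact pulls_mono _ i hT
    rw [integral_const, probReal_univ, one_smul] at hle
    have : 0 ≤ k / (1 - ∑ i, r i) := by positivity
    linarith
  · have hlt : (T : ℝ) ≤ (∑ i, r i) * T + k := by
      calc (T : ℝ) ≤ ∑ j, (n j : ℝ) := by exact_mod_cast hT.le
        _ ≤ ∑ j, (r j * T + 1) := by
            refine Finset.sum_le_sum fun j _ => ?_
            have h₁ : (n j : ℝ) ≤ ⌊r j * T⌋₊ + 1 := by exact_mod_cast hn.le_floor_add_one j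
            have := Nat.floor_le (mul_nonneg (hr j) (Nat.cast_nonneg (α := ℝ) T))
            linarith
        _ = (∑ i, r i) * T + k := by simp [Finset.sum_add_distrib, Finset.sum_mul]
    have hTk : (T : ℝ) ≤ k / (1 - ∑ i, r i) := by
      rw [le_div_iff₀ hρ]
      linarith
    have h0 : 0 ≤ ∫ ω, (pulls (fun s => a s ω) i T : ℝ) ∂P :=
      integral_nonneg fun ω => Nat.cast_nonneg _
    -- Even with no pull at all, the deficit is at most `r i * T ≤ T`.
    have := Nat.floor_le (mul_nonneg (hr i) (Nat.cast_nonneg (α := ℝ) T))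
    have := mul_le_of_le_one_left (Nat.cast_nonneg (α := ℝ) T) (hr1' i)
    linarith

lemma rRegret_zero_eq [NeZero k] (hr : ∀ i, 0 ≤ r i) :
    rRegret P μ r 0 T a =
      ∑ i, gap μ i * (∫ ω, (pulls (fun s => a s ω) i T : ℝ) ∂P - ⌊r i * T⌋₊) := by
  refine Finset.sum_congr rfl fun i _ => ?_
  have h := mul_nonneg (hr i) (Nat.cast_nonneg (α := ℝ) T)
  rw [sub_zero, ← natCast_floor_eq_intCast_floor h, max_eq_right (Nat.cast_nonneg _)]

variable [NeZero k] [IsProbabilityMeasure P]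

/-- The pull counts are random and depend on the rewards, so the deviation events are united over
every possible count `s ≤ t`, each costing `2/(t+1)^4`. -/
lemma measureReal_latePull_le (hX : IsBernoulliRewards P μ X) (hn : ∀ i, 1 ≤ n i)
    (hrun : ∀ᵐ ω ∂P, IsTFairUCBRun T n (fun i s => X i s ω) (fun t => a t ω))
    {i : Fin k} (hΔ : 0 < gap μ i) {M : ℕ} (hM : 8 * Real.log T / gap μ i ^ 2 ≤ M)
    {t : ℕ} (ht : ∑ j, n j ≤ t) (htT : t < T) :
    P.real (latePull a i M t) ≤ 2 * (t : ℝ) / ((t : ℝ) + 1) ^ 4 := by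
  let U (s : ℕ) : Set Ω :=
    {ω | empMean (fun j => X 0 j ω) s + √(2 * Real.log ((t : ℝ) + 1) / s) ≤ μ 0} ∪
      {ω | μ i + √(2 * Real.log ((t : ℝ) + 1) / s) ≤ empMean (fun j => X i j ω) s}
  have hsub : latePull a i M t ≤ᵐ[P] (⋃ s ∈ Finset.Icc 1 t, U s : Set Ω) := by
    filter_upwards [hrun] with ω hω hlate
    obtain ⟨hat, hMp⟩ := hlate
    -- The initial phase pulls every arm, so the default value 0 of `ucbEstimate` never occurs.
    have hpos (j : Fin k) : 1 ≤ pulls (fun s => a s ω) j t :=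
      ((hn j).trans_eq (hω.initial (ht.trans htT.le) j).symm).trans (pulls_mono _ j ht)
    have hmem (j : Fin k) : pulls (fun s => a s ω) j t ∈ Finset.Icc 1 t :=
      Finset.mem_Icc.2 ⟨hpos j, pulls_le _ j t⟩
    have hu := hω.ucb t ht htT 0
    rw [hat] at hu
    rcases deviation_of_ucbEstimate_le hΔ htT (Nat.one_le_iff_ne_zero.1 (hpos 0))
      (Nat.one_le_iff_ne_zero.1 (hpos i)) (hM.trans (by exact_mod_cast hMp)) hu with h | h
    · exact Set.mem_biUnion (hmem 0) (Or.inl h)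
    · exact Set.mem_biUnion (hmem i) (Or.inr h)
  have hU : ∀ s ∈ Finset.Icc 1 t, P.real (U s) ≤ 2 / ((t : ℝ) + 1) ^ 4 := by
    intro s hs
    have hs' : s ≠ 0 := Nat.one_le_iff_ne_zero.1 (Finset.mem_Icc.1 hs).1
    have hτ : (1 : ℝ) ≤ (t : ℝ) + 1 := by linarith [Nat.cast_nonneg (α := ℝ) t]
    calc P.real (U s) ≤ 1 / ((t : ℝ) + 1) ^ 4 + 1 / ((t : ℝ) + 1) ^ 4 :=
          (measureReal_union_le _ _).trans (add_le_add (hX.measureReal_empMean_le_le 0 hs' hτ)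
            (hX.measureReal_empMean_ge_le i hs' hτ))
      _ = 2 / ((t : ℝ) + 1) ^ 4 := by ring
  calc P.real (latePull a i M t) ≤ P.real (⋃ s ∈ Finset.Icc 1 t, U s) :=
        ENNReal.toReal_mono (measure_ne_top _ _) (measure_mono_ae hsub)
    _ ≤ ∑ s ∈ Finset.Icc 1 t, P.real (U s) := measureReal_biUnion_finset_le _ _
    _ ≤ ∑ s ∈ Finset.Icc 1 t, 2 / ((t : ℝ) + 1) ^ 4 := Finset.sum_le_sum hU
    _ = 2 * (t : ℝ) / ((t : ℝ) + 1) ^ 4 := by simp; ring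

lemma integral_pulls_le (hX : IsBernoulliRewards P μ X) (hn : ∀ i, 1 ≤ n i)
    (ha : ∀ t, Measurable (a t))
    (hrun : ∀ᵐ ω ∂P, IsTFairUCBRun T n (fun i s => X i s ω) (fun t => a t ω))
    {i : Fin k} (hΔ : 0 < gap μ i) {M : ℕ} (hM : 8 * Real.log T / gap μ i ^ 2 ≤ M)
    (hnM : n i ≤ M) :
    ∫ ω, (pulls (fun s => a s ω) i T : ℝ) ∂P ≤ M + 2 := by
  rcases le_or_gt (∑ j, n j) T with hT | hT
  · have h1 : 1 ≤ ∑ j, n j :=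
      (hn i).trans (Finset.single_le_sum (fun _ _ => Nat.zero_le _) (Finset.mem_univ i))
    have h1' : (1 : ℝ) ≤ (∑ j, n j : ℕ) := by exact_mod_cast h1
    have hinit : ∀ᵐ ω ∂P, pulls (fun s => a s ω) i (∑ j, n j) ≤ M := by
      filter_upwards [hrun] with ω hω
      rwa [hω.initial hT i]
    have hsum := Finset.sum_le_sum fun t ht =>
      measureReal_latePull_le hX hn hrun hΔ hM (Finset.mem_Ico.1 ht).1 (Finset.mem_Ico.1 ht).2
    have htel := sum_Ico_two_mul_div_le h1 hT
    have hdiv : (2 : ℝ) / (∑ j, n j : ℕ) ≤ 2 := div_le_self (by norm_num) h1'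
    have hdiv' : (0 : ℝ) ≤ 2 / T := by positivity
    linarith [integral_pulls_le_add_sum ha i hinit hT]
  · have hle : ∫ ω, (pulls (fun s => a s ω) i T : ℝ) ∂P ≤ ∫ _, (M : ℝ) ∂P := by
      refine integral_mono_ae (integrable_pulls ha i T) (integrable_const _) ?_
      filter_upwards [hrun] with ω hω
      exact Nat.cast_le.2 ((hω.initial_cut hT i).trans hnM)
    rw [integral_const, probReal_univ, one_smul] at hle
    linarith

open scoped Classical in
/-- The expected number of pulls of a suboptimal arm in excess of its quota. -/
lemma integral_pulls_sub_floor_le (hX : IsBernoulliRewards P μ X) (hr : ∀ i, 0 ≤ r i)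
    (hn : IsInitialPulls r T n) (ha : ∀ t, Measurable (a t))
    (hrun : ∀ᵐ ω ∂P, IsTFairUCBRun T n (fun i s => X i s ω) (fun t => a t ω))
    {i : Fin k} (hΔ : 0 < gap μ i) :
    ∫ ω, (pulls (fun s => a s ω) i T : ℝ) ∂P - ⌊r i * T⌋₊ ≤
      1 + Real.pi ^ 2 / 3 +
        if i ∈ underSampled μ r T then 8 * Real.log T / gap μ i ^ 2 - r i * T else 0 := by
  -- So `1 + π²/3 ≥ 4`, which covers the 2 from late pulls, the 1 in `M`, and the 1 lost in
  -- replacing `⌊r i * T⌋₊` by `r i * T`.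
  have hpi : 9 ≤ Real.pi ^ 2 := by nlinarith [Real.pi_gt_three]
  have hrT : 0 ≤ r i * T := mul_nonneg (hr i) (Nat.cast_nonneg T)
  have hfl := Nat.lt_floor_add_one (r i * T)
  split_ifs with hS
  · have hS' : r i * T < 8 * Real.log T / gap μ i ^ 2 := hS
    have hb := integral_pulls_le hX hn.one_le ha hrun hΔ
      (M := ⌊8 * Real.log T / gap μ i ^ 2⌋₊ + 1)
      (by push_cast; exact (Nat.lt_floor_add_one _).le)
      ((hn.le_floor_add_one i).trans (Nat.add_le_add_right (Nat.floor_le_floor hS'.le) 1))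
    have := Nat.floor_le (hrT.trans hS'.le)
    push_cast at hb
    linarith
  · have hS' : 8 * Real.log T / gap μ i ^ 2 ≤ r i * T := not_lt.1 hS
    have hb := integral_pulls_le hX hn.one_le ha hrun hΔ (M := ⌊r i * T⌋₊ + 1)
      (by push_cast; exact hS'.trans hfl.le) (hn.le_floor_add_one i)
    push_cast at hb
    linarith

open scoped Classical in
lemma rRegret_le (hμ : StrictAnti μ) (hX : IsBernoulliRewards P μ X) (hr : ∀ i, 0 ≤ r i)
    (hn : IsInitialPulls r T n) (ha : ∀ t, Measurable (a t))
    (hrun : ∀ᵐ ω ∂P, IsTFairUCBRun T n (fun i s => X i s ω) (fun t => a t ω)) :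
    rRegret P μ r 0 T a ≤
      (1 + Real.pi ^ 2 / 3) * ∑ i, gap μ i +
        ∑ i ∈ Finset.univ.filter (fun i => i ∈ underSampled μ r T ∧ i ≠ 0),
          gap μ i * (8 * Real.log T / gap μ i ^ 2 - r i * T) := by
  rw [rRegret_zero_eq hr, Finset.mul_sum, Finset.sum_filter, ← Finset.sum_add_distrib]
  refine Finset.sum_le_sum fun i _ => ?_
  by_cases hi : i = 0
  · simp [hi, gap_zero]
  · have hΔ := gap_pos hμ hi
    refine (mul_le_mul_of_nonneg_left
      (integral_pulls_sub_floor_le hX hr hn ha hrun hΔ) hΔ.le).trans_eq ?_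
    by_cases hS : i ∈ underSampled μ r T <;> simp only [hS, hi, ne_eq, not_false_eq_true, and_self,
      false_and, if_true, if_false] <;> ring

end Run

end FairMAB

/-! ### The logarithmic bound and the explicit bound -/

open FairMAB in
open scoped Classical in
theorem theorem8 {k : ℕ} [NeZero k] (μ : Fin k → I) (r : Fin k → ℝ)
    (hμ : StrictAnti μ) (hr : ∀ i, 0 ≤ r i ∧ r i < 1 / (k : ℝ)) :
    ∃ C : ℝ, ∀ (Ω : Type*) [MeasurableSpace Ω] (P : Measure Ω) [IsProbabilityMeasure P]
      (X : Fin k → ℕ → Ω → ℝ) (_ : IsBernoulliRewards P μ X)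
      (T : ℕ) (_ : 1 ≤ T) (n : Fin k → ℕ) (_ : IsInitialPulls r T n)
      (a : ℕ → Ω → Fin k) (_ : ∀ t, Measurable (a t))
      (_ : ∀ᵐ ω ∂P, IsTFairUCBRun T n (fun i s => X i s ω) (fun t => a t ω)),
      (2 ≤ T → |rRegret P μ r 0 T a| ≤ C * Real.log T) ∧
      rRegret P μ r 0 T a ≤
        (1 + Real.pi ^ 2 / 3) * ∑ i, gap μ i +
          ∑ i ∈ Finset.univ.filter (fun i => i ∈ underSampled μ r T ∧ i ≠ 0),
            gap μ i * (8 * Real.log T / gap μ i ^ 2 - r i * T) := by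
  have hr0 : ∀ i, 0 ≤ r i := fun i => (hr i).1
  have hk : (1 : ℝ) ≤ k := by exact_mod_cast NeZero.one_le (n := k)
  have hr1 : ∑ i, r i < 1 := by
    calc ∑ i, r i < ∑ _i : Fin k, 1 / (k : ℝ) :=
          Finset.sum_lt_sum_of_nonempty Finset.univ_nonempty fun i _ => (hr i).2
      _ = 1 := by
          rw [Finset.sum_const, Finset.card_fin, nsmul_eq_mul]
          field_simp
  have hr1' : ∀ i, r i ≤ 1 := fun i =>
    (hr i).2.le.trans (div_le_one_of_le₀ hk (by positivity))
  set G : ℝ := ∑ i, gap μ i with hG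
  set B : ℝ := k / (1 - ∑ i, r i) with hB
  set D : ℝ := ∑ i, gap μ i * (8 / gap μ i ^ 2) with hD
  have hG0 : 0 ≤ G := Finset.sum_nonneg fun i _ => gap_nonneg hμ i
  have hB0 : 0 ≤ B := div_nonneg (Nat.cast_nonneg k) (by linarith)
  have hD0 : 0 ≤ D := Finset.sum_nonneg fun i _ => mul_nonneg (gap_nonneg hμ i) (by positivity)
  -- Dividing by `ln 2` lets `ln T` absorb the constant terms for `T ≥ 2`; `B * G` bounds the
  -- negative part of the regret, and `D` collects the coefficients of `ln T`.
  refine ⟨((1 + Real.pi ^ 2 / 3) * G + B * G) / Real.log 2 + D, ?_⟩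
  intro Ω _ P _ X hX T hT n hn a ha hrun
  have hub := rRegret_le hμ hX hr0 hn ha hrun
  refine ⟨fun hT2 => ?_, hub⟩
  have hl2 : 0 < Real.log 2 := Real.log_pos (by norm_num)
  have hlT : Real.log 2 ≤ Real.log T := Real.log_le_log (by norm_num) (by exact_mod_cast hT2)
  have hlog : 0 ≤ Real.log T := hl2.le.trans hlT
  have hlb : -(B * G) ≤ rRegret P μ r 0 T a := by
    rw [rRegret_zero_eq hr0, hG, Finset.mul_sum, ← Finset.sum_neg_distrib]
    refine Finset.sum_le_sum fun i _ => ?_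
    have := mul_le_mul_of_nonneg_left
      (neg_le_integral_pulls_sub_floor hr0 hr1 hr1' hn ha hrun i) (gap_nonneg hμ i)
    rw [← hB] at this
    linarith
  have hS : ∑ i ∈ Finset.univ.filter (fun i => i ∈ underSampled μ r T ∧ i ≠ 0),
      gap μ i * (8 * Real.log T / gap μ i ^ 2 - r i * T) ≤ D * Real.log T := by
    rw [hD, Finset.sum_mul]
    calc _ ≤ ∑ i ∈ Finset.univ.filter (fun i => i ∈ underSampled μ r T ∧ i ≠ 0),
          gap μ i * (8 / gap μ i ^ 2) * Real.log T := by
          refine Finset.sum_le_sum fun i _ => ?_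
          rw [mul_assoc, div_mul_eq_mul_div]
          exact mul_le_mul_of_nonneg_left
            (sub_le_self _ (mul_nonneg (hr0 i) (Nat.cast_nonneg T))) (gap_nonneg hμ i)
      _ ≤ _ := Finset.sum_le_univ_sum_of_nonneg fun i =>
          mul_nonneg (mul_nonneg (gap_nonneg hμ i) (by positivity)) hlog
  have hE0 : 0 ≤ (1 + Real.pi ^ 2 / 3) * G + B * G := by positivity
  have hE : (1 + Real.pi ^ 2 / 3) * G + B * G ≤
      ((1 + Real.pi ^ 2 / 3) * G + B * G) / Real.log 2 * Real.log T := by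
    rw [div_mul_eq_mul_div _ _ (Real.log T), le_div_iff₀ hl2]
    exact mul_le_mul_of_nonneg_left hlT hE0
  have hBG : 0 ≤ B * G := by positivity
  have hPG : 0 ≤ (1 + Real.pi ^ 2 / 3) * G := by positivity
  have hDl : 0 ≤ D * Real.log T := by positivity
  rw [add_mul, abs_le]
  constructor <;> linarith
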